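/- Let $2\le k\le n$ be integers and write $[n]=\{1,\dots,n\}$, $[k,n]=\{k,\dots,n\}$. Let $\mathcal A^k_n$ be the arrangement in $\mathbb R^n$ consisting of the hyperplanes $x_i=x_j$ ($1\le i<j\le n$), $x_1=x_j+i$ ($1\le i<j\le n$, $i<k$) and $x_i=x_j+1$ ($k\le i<j\le n$). Let $\mathcal G^k_n$ be the directed multigraph on $[n]$ with one arc $(i,j)$ for each hyperplane $x_i=x_j$, $i<j$, of $\mathcal A^k_n$ and one arc $(j,i)$ for each hyperplane $x_i=x_j+a$, $a\ge 1$, of $\mathcal A^k_n$. A tuple $\mathbf a=(a_1,\dots,a_n)$ of positive integers is a $\mathcal G^k_n$-parking function if every non-empty $I\subseteq[n]$ contains a vertex $i$ such that the number of arcs $(i,j)$ with $j\notin I$, counted with multiplicity, is greater than $a_i-2$. For $\mathbf a\in[n]^n$, let drivers $n,n-1,\dots,1$ enter a street one by one in this order, driver $i$ taking the first free place $p\ge a_i$ (places beyond $n$ being available); $\mathbf a$ parks $i$ if the place taken by driver $i$ is at most $n$. The centre $Z(\mathbf a)$ is the largest (possibly empty) subset $\{i_1>\dots>i_m\}$ of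 $[n]$ with $a_{i_j}\le j$ for all $j\in[m]$. Let $\mathbf a^{(k)}$ be obtained from $\mathbf a$ by rearranging the entries $a_k,\dots,a_n$ in weakly decreasing order and leaving $a_1,\dots,a_{k-1}$ in place. Then $\mathbf a\in[n]^n$ is a $k$-partial parking function if $\mathbf a$ parks every element of $[k,n]$ and $1\in Z(\mathbf a^{(k)})$. **Theorem.** For all integers $2\le k\le n$, the $\mathcal G^k_n$-parking functions are exactly the $k$-partial parking functions, and their number is $(n+1)^{n-1}$. -/

import Mathlib

/-! Throughout, the index set `{1, …, n}` is modelled by `Fin n`: the element `i : Fin n`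
stands for the number `(i : ℕ) + 1`. -/

namespace ShiIsh

/-- A finite directed loopless multigraph on `V`: `mult u v` is the number of arcs `(u, v)`. -/
structure MultiDigraph (V : Type*) where
  mult : V → V → ℕ
  loopless : ∀ v, mult v v = 0

/-- `a : V → {1, 2, …}` is a `G`-parking function if every non-empty `I ⊆ V` has a vertex `i ∈ I`
such that the number of arcs from `i` to vertices outside `I` is greater than `a i - 2`
(an inequality between integers). -/
def MultiDigraph.IsParkingFunction {V : Type*} [Fintype V] [DecidableEq V]
    (G : MultiDigraph V) (a : V → ℕ) : Prop :=
  (∀ v, 1 ≤ a v) ∧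
    ∀ I : Finset V, I.Nonempty → ∃ i ∈ I, (a i : ℤ) - 2 < ((∑ j ∈ Iᶜ, G.mult i j : ℕ) : ℤ)

/-- The hyperplane `x_i = x_j + a` of `ℝⁿ`. -/
def hyperplane {n : ℕ} (i j : Fin n) (a : ℕ) : Set (Fin n → ℝ) :=
  {x | x i = x j + a}

/-- The arrangement between Shi and Ish. It consists of the hyperplanes
`x_i = x_j` for `1 ≤ i < j ≤ n`, `x_1 = x_j + i` for `1 ≤ i < j ≤ n` with `i < k`, and
`x_i = x_j + 1` for `k ≤ i < j ≤ n`. -/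
def arrangement (n k : ℕ) : Set (Set (Fin n → ℝ)) :=
  {H | ∃ i j : Fin n, i < j ∧ H = hyperplane i j 0} ∪
  {H | ∃ i j : Fin n, i < j ∧ (i : ℕ) + 1 < k ∧ H = hyperplane ⟨0, j.pos⟩ j ((i : ℕ) + 1)} ∪
  {H | ∃ i j : Fin n, k ≤ (i : ℕ) + 1 ∧ i < j ∧ H = hyperplane i j 1}

/-- The hyperplane `H` gives rise to an arc `(u, v)`: either `H` is `x_u = x_v` with `u < v`,
or `H` is `x_v = x_u + a` for some positive integer `a`. -/
def GivesArc {n : ℕ} (H : Set (Fin n → ℝ)) (u v : Fin n) : Prop :=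
  (u < v ∧ H = hyperplane u v 0) ∨ ∃ a : ℕ, 0 < a ∧ H = hyperplane v u a

theorem nonempty_of_mem_arrangement {n k : ℕ} {H : Set (Fin n → ℝ)}
    (hH : H ∈ arrangement n k) : H.Nonempty := by
  have key : ∀ (i j : Fin n) (a : ℕ), i < j → (hyperplane i j a).Nonempty := by
    intro i j a hij
    refine ⟨fun l => if l = i then (a : ℝ) else 0, ?_⟩
    simp [hyperplane, hij.ne']
  rcases hH with (⟨i, j, hij, rfl⟩ | ⟨i, j, hij, _, rfl⟩) | ⟨i, j, _, hij, rfl⟩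
  · exact key _ _ _ hij
  · refine key _ _ _ ?_
    rw [Fin.lt_def] at hij ⊢
    exact lt_of_le_of_lt (Nat.zero_le _) hij
  · exact key _ _ _ hij

/-- The multigraph of the arrangement: one arc `(i, j)` with `i < j` for each hyperplane
`x_i = x_j`, and one arc `(j, i)` for each hyperplane `x_i = x_j + a` with `a ≥ 1`. -/
noncomputable def graph (n k : ℕ) : MultiDigraph (Fin n) where
  mult u v := {H ∈ arrangement n k | GivesArc H u v}.ncard
  loopless v := by
    have h : {H ∈ arrangement n k | GivesArc H v v} = ∅ := by
      ext H
      simp only [Set.mem_ofPred_eq, Set.mem_empty_iff_false, iff_false, not_and]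
      rintro hH (⟨h, _⟩ | ⟨a, ha, rfl⟩)
      · exact lt_irrefl _ h
      · obtain ⟨x, hx⟩ := nonempty_of_mem_arrangement hH
        simp only [hyperplane, Set.mem_ofPred_eq, left_eq_add, Nat.cast_eq_zero] at hx
        omega
    rw [h, Set.ncard_empty]

/-- The place taken by driver `i` in the parking algorithm with preferences `a`: the drivers
enter in descending order `n, n - 1, …, 1`, and each takes the first place `p ≥ a i` that is not
yet occupied. (Places beyond `n` are available, so the set below is never empty.) -/
noncomputable def place {n : ℕ} (a : Fin n → ℕ) (i : Fin n) : ℕ :=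
  sInf {p | a i ≤ p ∧ ∀ j, (_h : i < j) → place a j ≠ p}
termination_by n - (i : ℕ)

/-- `a` parks `i` if driver `i` takes one of the places `1, …, n`. -/
def Parks {n : ℕ} (a : Fin n → ℕ) (i : Fin n) : Prop := place a i ≤ n

/-- `X = {i_1 > ⋯ > i_m}` satisfies `a_{i_j} ≤ j` for every `j`: the position of `i ∈ X` in the
descending enumeration of `X` is the number of elements of `X` that are at least `i`. -/
def IsCentral {n : ℕ} (a : Fin n → ℕ) (X : Finset (Fin n)) : Prop :=
  ∀ i ∈ X, a i ≤ {l ∈ X | i ≤ l}.card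

open Classical in
/-- The centre of `a`: the largest (possibly empty) subset of the index set which is central,
obtained as the union of all central subsets. -/
noncomputable def centre {n : ℕ} (a : Fin n → ℕ) : Finset (Fin n) :=
  {X : Finset (Fin n) | IsCentral a X}.toFinset.sup id

theorem isGreatest_centre {n : ℕ} (a : Fin n → ℕ) :
    IsGreatest {X : Finset (Fin n) | IsCentral a X} (centre a) := by
  classical
  constructor
  · intro i hi
    obtain ⟨X, hX, hiX⟩ := Finset.mem_sup.1 hi
    have hX' : IsCentral a X := by simpa using hX
    refine (hX' i hiX).trans (Finset.card_le_card ?_)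
    exact Finset.filter_subset_filter _ (Finset.le_sup (f := id) hX)
  · intro X hX
    exact Finset.le_sup (f := id) (by simpa using hX)

/-- `π` is a permutation that fixes every `i < k` and arranges the entries of `a` at
`k, …, n` in weakly decreasing order. Such `π` exists, and `a ∘ π` does not depend on its
choice. -/
def IsSorting {n : ℕ} (k : ℕ) (a : Fin n → ℕ) (π : Equiv.Perm (Fin n)) : Prop :=
  (∀ i : Fin n, (i : ℕ) + 1 < k → π i = i) ∧
    ∀ i j : Fin n, k ≤ (i : ℕ) + 1 → (j : ℕ) = (i : ℕ) + 1 → a (π j) ≤ a (π i)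

/-- `a ∈ {1, …, n}ⁿ` is a `k`-partial parking function if it parks all the elements of
`{k, …, n}` and `1` belongs to the centre of `a ∘ π`, the rearrangement of `a` whose entries at
`k, …, n` are in weakly decreasing order. -/
def IsPartialParkingFunction (n k : ℕ) (a : Fin n → ℕ) : Prop :=
  (∀ i, 1 ≤ a i ∧ a i ≤ n) ∧
  (∀ i : Fin n, k ≤ (i : ℕ) + 1 → Parks a i) ∧
  ∃ π : Equiv.Perm (Fin n), IsSorting k a π ∧ ∃ o ∈ centre (a ∘ π), (o : ℕ) + 1 = 1

end ShiIsh

/-! The two halves of the theorem are independent of each other.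

For the count, any multigraph `G` is completed by a sink receiving one arc from every vertex. The
parking functions of `G`, shifted by one, are then the superstable configurations of the chip-firing
game, and every coset of the lattice spanned by the columns of the reduced Laplacian contains exactly
one of them: uniqueness follows by firing the set where a firing vector is maximal, existence by
taking a longest legal firing vector (`MultiDigraph.ncard_isParkingFunction`). So their number is the
absolute value of the determinant of the reduced Laplacian. For the multigraph of the arrangement
every row of this matrix sums to `1`, the diagonal entries are `n`, and the entries above the
diagonal are `-1`; two column operations make it triangular with diagonal `1, n + 1, …, n + 1`
(`det_reducedLaplacian_graph`).

For the equivalence, think of a parking function as a sequence of vertices that burns completely: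
vertex `i` burns once `a i - 1` is at most the number of its arcs into the burnt set. Before `1` is burnt,
a vertex `i < k` only profits from burnt vertices above `i`, and a vertex `i ≥ k` only from burnt
vertices in `{k, …, n}`. The sets burnt in this phase (`IsBurnable`) correspond to the central sets
of the sequence sorted on `{k, …, n}`, so the fire reaches `1` exactly if `1` lies in the centre
(`IsCentral.isBurnable_map`, `IsBurnable.exists_isCentral`). Once `1` is burnt, every vertex `i ≥ k`
gains `k - 1` arcs; these vertices all burn exactly if the drivers `k, …, n` park
(`isTailParking_of_parks`, `parks_of_isTailParking`). The vertices strictly between `1` and `k` then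
burn in descending order, since they have `n - 1` arcs to the burnt set and `a i ≤ n`. -/

namespace ShiIsh

/-! ### Parking functions of a multigraph and its reduced Laplacian -/

section Laplacian

open Matrix

variable {V : Type*} [Fintype V] [DecidableEq V]

/-- The reduced Laplacian of `G` extended by a sink that receives one arc from every vertex.
Its `u`-th row describes the arcs leaving `u`; the row and the column of the sink are deleted. -/
def MultiDigraph.reducedLaplacian (G : MultiDigraph V) : Matrix V V ℤ :=
  Matrix.diagonal (fun u => 1 + ∑ v, (G.mult u v : ℤ)) - Matrix.of fun u v => (G.mult u v : ℤ)

theorem MultiDigraph.reducedLaplacian_mulVec (G : MultiDigraph V) (h : V → ℤ) (u : V) :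
    (G.reducedLaplacian *ᵥ h) u = h u + ∑ v, (G.mult u v : ℤ) * (h u - h v) := by
  rw [reducedLaplacian, Matrix.sub_mulVec, Pi.sub_apply, Matrix.mulVec_diagonal]
  simp only [Matrix.mulVec, dotProduct, Matrix.of_apply, mul_sub, Finset.sum_sub_distrib,
    ← Finset.sum_mul]
  ring

/-- The integer indicator function of a finite set of vertices. -/
def indicatorVec (I : Finset V) : V → ℤ := fun v => if v ∈ I then 1 else 0

/-- Firing `I` once costs a vertex of `I` its arcs to the sink and to the complement of `I`. -/
theorem MultiDigraph.reducedLaplacian_indicator_of_mem (G : MultiDigraph V) {I : Finset V} {u : V}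
    (hu : u ∈ I) :
    (G.reducedLaplacian *ᵥ indicatorVec I) u = 1 + ((∑ j ∈ Iᶜ, G.mult u j : ℕ) : ℤ) := by
  rw [reducedLaplacian_mulVec]
  simp only [indicatorVec, hu, if_true, Nat.cast_sum]
  rw [← Finset.sum_add_sum_compl I, Finset.sum_eq_zero, zero_add]
  · congr 1
    refine Finset.sum_congr rfl fun j hj => ?_
    simp [Finset.mem_compl.1 hj]
  · intro j hj
    simp [hj]

theorem MultiDigraph.reducedLaplacian_indicator_of_notMem (G : MultiDigraph V) {I : Finset V}
    {u : V} (hu : u ∉ I) : (G.reducedLaplacian *ᵥ indicatorVec I) u ≤ 0 := by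
  rw [reducedLaplacian_mulVec]
  simp only [indicatorVec, hu, if_false, zero_sub, zero_add]
  refine Finset.sum_nonpos fun j _ => ?_
  split_ifs <;> simp

/-- A configuration `f` is superstable if it is nonnegative and firing any non-empty set of
vertices makes it negative somewhere on that set. -/
def MultiDigraph.IsSuperstable (G : MultiDigraph V) (f : V → ℤ) : Prop :=
  (∀ v, 0 ≤ f v) ∧
    ∀ I : Finset V, I.Nonempty → ∃ i ∈ I, f i < (G.reducedLaplacian *ᵥ indicatorVec I) i

theorem MultiDigraph.isParkingFunction_iff (G : MultiDigraph V) (a : V → ℕ) :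
    G.IsParkingFunction a ↔ G.IsSuperstable fun v => (a v : ℤ) - 1 := by
  refine and_congr (forall_congr' fun v => by simp only; omega) (forall_congr' fun I =>
    imp_congr_right fun _ => exists_congr fun i => and_congr_right fun hi => ?_)
  rw [G.reducedLaplacian_indicator_of_mem hi]
  simp only
  omega

/-- The maximum principle for the reduced Laplacian. -/
theorem MultiDigraph.le_reducedLaplacian_mulVec (G : MultiDigraph V) {h : V → ℤ} {u : V}
    (hu : ∀ v, h v ≤ h u) : h u ≤ (G.reducedLaplacian *ᵥ h) u := by
  rw [reducedLaplacian_mulVec]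
  have : 0 ≤ ∑ v, (G.mult u v : ℤ) * (h u - h v) :=
    Finset.sum_nonneg fun v _ => mul_nonneg (by positivity) (sub_nonneg.2 (hu v))
  omega

/-- If firing `h` leads from a superstable configuration to a nonnegative one, then `h ≤ 0`:
otherwise the set where `h` is maximal could be fired legally. -/
theorem MultiDigraph.IsSuperstable.nonpos {G : MultiDigraph V} {f h : V → ℤ}
    (hf : G.IsSuperstable f) (hg : ∀ v, 0 ≤ f v - (G.reducedLaplacian *ᵥ h) v) (v : V) :
    h v ≤ 0 := by
  obtain ⟨m, -, hm⟩ := Finset.exists_max_image Finset.univ h ⟨v, Finset.mem_univ v⟩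
  replace hm : ∀ x, h x ≤ h m := fun x => hm x (Finset.mem_univ x)
  refine (hm v).trans ?_
  by_contra! hpos
  obtain ⟨i, hi, hlt⟩ := hf.2 (Finset.univ.filter fun x => h x = h m) ⟨m, by simp⟩
  rw [G.reducedLaplacian_indicator_of_mem hi] at hlt
  replace hi : h i = h m := by simpa using hi
  have hfi := hg i
  rw [reducedLaplacian_mulVec, ← Finset.sum_add_sum_compl (Finset.univ.filter fun x => h x = h m)]
    at hfi
  have h1 : 0 ≤ ∑ x ∈ Finset.univ.filter fun x => h x = h m, (G.mult i x : ℤ) * (h i - h x) :=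
    Finset.sum_nonneg fun x _ => mul_nonneg (by positivity) (by linarith [hm x])
  have h2 : ((∑ j ∈ (Finset.univ.filter fun x => h x = h m)ᶜ, G.mult i j : ℕ) : ℤ) ≤
      ∑ x ∈ (Finset.univ.filter fun x => h x = h m)ᶜ, (G.mult i x : ℤ) * (h i - h x) := by
    push_cast
    refine Finset.sum_le_sum fun x hx => le_mul_of_one_le_right (by positivity) ?_
    have : h x ≠ h m := by simpa using hx
    have := hm x
    omega
  omega

theorem MultiDigraph.IsSuperstable.eq_of_sub_eq {G : MultiDigraph V} {f g h : V → ℤ}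
    (hf : G.IsSuperstable f) (hg : G.IsSuperstable g)
    (hfg : f - g = G.reducedLaplacian *ᵥ h) : f = g := by
  have h1 : ∀ v, h v ≤ 0 := hf.nonpos fun v => by
    have := congrFun hfg v
    simp only [Pi.sub_apply] at this
    linarith [hg.1 v]
  have h2 : ∀ v, (-h) v ≤ 0 := hg.nonpos fun v => by
    have := congrFun hfg v
    simp only [Pi.sub_apply, Matrix.mulVec_neg, Pi.neg_apply] at this ⊢
    linarith [hf.1 v]
  have h0 : h = 0 := funext fun v => le_antisymm (h1 v) (by simpa using h2 v)
  rwa [h0, Matrix.mulVec_zero, sub_eq_zero] at hfg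

theorem MultiDigraph.reducedLaplacian_injective (G : MultiDigraph V) :
    Function.Injective G.reducedLaplacian.mulVecLin := by
  have key : ∀ h : V → ℤ, G.reducedLaplacian *ᵥ h = 0 → ∀ v, h v ≤ 0 := by
    intro h h0 v
    obtain ⟨m, -, hm⟩ := Finset.exists_max_image Finset.univ h ⟨v, Finset.mem_univ v⟩
    have := G.le_reducedLaplacian_mulVec (u := m) fun x => hm x (Finset.mem_univ x)
    rw [h0] at this
    exact (hm v (Finset.mem_univ v)).trans this
  rw [← LinearMap.ker_eq_bot, LinearMap.ker_eq_bot']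
  intro h h0
  rw [Matrix.mulVecLin_apply] at h0
  refine funext fun v => le_antisymm (key h h0 v) ?_
  simpa using key (-h) (by rw [Matrix.mulVec_neg, h0, neg_zero]) v

/-- Every configuration becomes superstable after suitable firings. The configuration is first
made nonnegative by unfiring all vertices often enough; then a longest firing vector that keeps it
nonnegative is taken, which exists by the maximum principle. -/
theorem MultiDigraph.exists_isSuperstable (G : MultiDigraph V) (f : V → ℤ) :
    ∃ h : V → ℤ, G.IsSuperstable (f - G.reducedLaplacian *ᵥ h) := by
  obtain ⟨N, hN⟩ : ∃ N : ℤ, ∀ v, |f v| ≤ N :=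
    ⟨∑ v, |f v|, fun v => Finset.single_le_sum (f := fun v => |f v|)
      (fun _ _ => abs_nonneg _) (Finset.mem_univ v)⟩
  set f₀ : V → ℤ := f + G.reducedLaplacian *ᵥ (fun _ => N) with hf₀
  have hf₀v : ∀ v, f₀ v = f v + N := fun v => by
    simp [hf₀, reducedLaplacian_mulVec]
  set S : Set (V → ℤ) := {h | (∀ v, 0 ≤ h v) ∧ ∀ v, 0 ≤ f₀ v - (G.reducedLaplacian *ᵥ h) v}
    with hS
  have hSfin : S.Finite := by
    refine (Set.finite_Icc (0 : V → ℤ) (fun _ => 2 * N)).subset fun h hh => ⟨hh.1, fun v => ?_⟩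
    obtain ⟨m, -, hm⟩ := Finset.exists_max_image Finset.univ h ⟨v, Finset.mem_univ v⟩
    have h1 := G.le_reducedLaplacian_mulVec (u := m) fun x => hm x (Finset.mem_univ x)
    have h2 := hh.2 m
    rw [hf₀v] at h2
    have h3 := le_abs_self (f m)
    have h4 := hN m
    have h5 := hm v (Finset.mem_univ v)
    show h v ≤ 2 * N
    omega
  have hSne : S.Nonempty := by
    refine ⟨0, fun v => le_rfl, fun v => ?_⟩
    have h3 := neg_abs_le (f v)
    have h4 := hN v
    rw [Matrix.mulVec_zero, hf₀v]
    simp only [Pi.zero_apply]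
    omega
  obtain ⟨h, hh, hmax⟩ := Set.exists_max_image S (fun h => ∑ v, h v) hSfin hSne
  refine ⟨h - fun _ => N, ?_⟩
  have heq : f - G.reducedLaplacian *ᵥ (h - fun _ => N) = f₀ - G.reducedLaplacian *ᵥ h := by
    rw [Matrix.mulVec_sub, hf₀]
    abel
  rw [heq]
  refine ⟨hh.2, fun I hI => ?_⟩
  by_contra! hcon
  have hmem : h + indicatorVec I ∈ S := by
    refine ⟨fun v => ?_, fun v => ?_⟩
    · have h1 := hh.1 v
      simp only [Pi.add_apply, indicatorVec]
      split_ifs <;> omega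
    · rw [Matrix.mulVec_add, Pi.add_apply]
      by_cases hv : v ∈ I
      · have h1 := hcon v hv
        rw [Pi.sub_apply] at h1
        omega
      · have h1 := G.reducedLaplacian_indicator_of_notMem hv
        have h2 := hh.2 v
        omega
  have h1 := hmax _ hmem
  have h2 : ∑ v, indicatorVec I v = (I.card : ℤ) := by simp [indicatorVec]
  simp only [Pi.add_apply, Finset.sum_add_distrib, h2] at h1
  have h3 := hI.card_pos
  omega

/-- The parking functions, shifted by one, form a system of representatives of the cokernel of the
reduced Laplacian, so their number is the absolute value of its determinant. -/
theorem MultiDigraph.ncard_isParkingFunction (G : MultiDigraph V) :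
    {a : V → ℕ | G.IsParkingFunction a}.ncard = G.reducedLaplacian.det.natAbs := by
  set N : Submodule ℤ (V → ℤ) := LinearMap.range G.reducedLaplacian.mulVecLin with hN
  have hcard : Nat.card ((V → ℤ) ⧸ N) = G.reducedLaplacian.det.natAbs := by
    rw [← Submodule.natAbs_det_equiv N (LinearEquiv.ofInjective _ G.reducedLaplacian_injective),
      ← LinearMap.det_toLin']
    rfl
  rw [← hcard, ← Nat.card_coe_set_eq]
  refine Nat.card_eq_of_bijective
    (fun a : {a : V → ℕ | G.IsParkingFunction a} => N.mkQ fun v => ((a : V → ℕ) v : ℤ) - 1)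
    ⟨?_, ?_⟩
  · rintro ⟨a, ha⟩ ⟨b, hb⟩ hab
    simp only [Submodule.mkQ_apply, Submodule.Quotient.eq, hN, LinearMap.mem_range,
      Matrix.mulVecLin_apply] at hab
    obtain ⟨h, hh⟩ := hab
    have := ((G.isParkingFunction_iff a).1 ha).eq_of_sub_eq ((G.isParkingFunction_iff b).1 hb)
      hh.symm
    refine Subtype.ext (funext fun v => ?_)
    have := congrFun this v
    simp only at this ⊢
    omega
  · intro q
    obtain ⟨f, rfl⟩ := N.mkQ_surjective q
    obtain ⟨h, hh⟩ := G.exists_isSuperstable f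
    set g := f - G.reducedLaplacian *ᵥ h with hg
    have hga : (fun v => (((g v).toNat + 1 : ℕ) : ℤ) - 1) = g :=
      funext fun v => by
        have := hh.1 v
        omega
    refine ⟨⟨fun v => (g v).toNat + 1, (G.isParkingFunction_iff _).2 (by rwa [hga])⟩, ?_⟩
    simp only [hga, Submodule.mkQ_apply, Submodule.Quotient.eq, hN, LinearMap.mem_range,
      Matrix.mulVecLin_apply]
    exact ⟨-h, by rw [Matrix.mulVec_neg, hg]; abel⟩

end Laplacian

/-! ### The arcs of the multigraph of the arrangement -/

theorem hyperplane_eq_hyperplane {n : ℕ} {i j i' j' : Fin n} {a a' : ℕ} (hij : i ≠ j)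
    (hij' : i' ≠ j') (h : hyperplane i j a = hyperplane i' j' a') :
    (i' = i ∧ j' = j ∧ a' = a) ∨ (i' = j ∧ j' = i ∧ a = 0 ∧ a' = 0) := by
  have key : ∀ x : Fin n → ℝ, x i = x j + a → x i' = x j' + a' := fun x hx => by
    have : x ∈ hyperplane i' j' a' := h ▸ hx
    exact this
  have h0 := key (fun l => if l = i then (a : ℝ) else 0) (by simp [hij.symm])
  -- Changing a coordinate other than `i` and `j` does not leave the first hyperplane.
  have bump : ∀ m, m ≠ i → m ≠ j → (if i' = i then (a : ℝ) else 0) + (if i' = m then 1 else 0) =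
      (if j' = i then (a : ℝ) else 0) + (if j' = m then 1 else 0) + a' := fun m hmi hmj =>
    key (fun l => (if l = i then (a : ℝ) else 0) + if l = m then 1 else 0)
      (by simp [hij.symm, hmi.symm, hmj.symm])
  have hi' : i' = i ∨ i' = j := by
    by_contra! hc
    have := bump i' hc.1 hc.2
    simp only [hij'.symm, if_true, if_false] at this h0
    linarith
  have hj' : j' = i ∨ j' = j := by
    by_contra! hc
    have := bump j' hc.1 hc.2
    simp only [hij', if_true, if_false] at this h0
    linarith
  rcases hi' with rfl | rfl <;> rcases hj' with rfl | rfl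
  · exact absurd rfl hij'
  · simp only [if_true, hij.symm, if_false, zero_add] at h0
    exact Or.inl ⟨rfl, rfl, by exact_mod_cast h0.symm⟩
  · simp only [if_true, hij.symm, if_false] at h0
    have : a + a' = 0 := by exact_mod_cast h0.symm
    exact Or.inr ⟨rfl, rfl, by omega, by omega⟩
  · exact absurd rfl hij'

theorem hyperplane_mem_arrangement_iff {n k : ℕ} (hk : 2 ≤ k) {u v : Fin n} (huv : u ≠ v) {a : ℕ}
    (ha : 0 < a) :
    hyperplane v u a ∈ arrangement n k ↔
      v < u ∧ (((v : ℕ) = 0 ∧ a ≤ min (u : ℕ) (k - 1)) ∨ (k ≤ (v : ℕ) + 1 ∧ a = 1)) := by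
  constructor
  · rintro ((⟨i, j, hij, h⟩ | ⟨i, j, hij, hik, h⟩) | ⟨i, j, hki, hij, h⟩)
    · rcases hyperplane_eq_hyperplane huv.symm hij.ne h with h' | h' <;> omega
    · have hne : (⟨0, j.pos⟩ : Fin n) ≠ j := by
        rw [Ne, Fin.ext_iff]
        simp only
        omega
      rcases hyperplane_eq_hyperplane huv.symm hne h with ⟨h1, h2, h3⟩ | h'
      · rw [Fin.ext_iff] at h1 h2
        simp only at h1
        rw [Fin.lt_def] at hij ⊢
        omega
      · omega
    · rcases hyperplane_eq_hyperplane huv.symm hij.ne h with ⟨rfl, rfl, h3⟩ | h'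
      · exact ⟨hij, Or.inr ⟨hki, h3.symm⟩⟩
      · omega
  · rintro ⟨hvu, ⟨hv, hau⟩ | ⟨hkv, rfl⟩⟩
    · refine Or.inl (Or.inr ⟨⟨a - 1, by omega⟩, u, ?_, ?_, ?_⟩)
      · rw [Fin.lt_def]
        simp only
        omega
      · simp only
        omega
      · have h1 : (⟨0, u.pos⟩ : Fin n) = v := Fin.ext hv.symm
        have h2 : a - 1 + 1 = a := by omega
        simp only [h1, h2]
    · exact Or.inr ⟨v, u, hkv, hvu, rfl⟩

theorem graph_mult_of_lt {n k : ℕ} (hk : 2 ≤ k) {u v : Fin n} (huv : u < v) :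
    (graph n k).mult u v = 1 := by
  have : {H ∈ arrangement n k | GivesArc H u v} = {hyperplane u v 0} := by
    ext H
    simp only [Set.mem_ofPred_eq, Set.mem_singleton_iff]
    constructor
    · rintro ⟨hH, ⟨_, h⟩ | ⟨a, ha, rfl⟩⟩
      · exact h
      · exact absurd ((hyperplane_mem_arrangement_iff hk huv.ne ha).1 hH).1 huv.not_gt
    · rintro rfl
      exact ⟨Or.inl (Or.inl ⟨u, v, huv, rfl⟩), Or.inl ⟨huv, rfl⟩⟩
  simp only [graph]
  rw [this, Set.ncard_singleton]

theorem graph_mult_of_gt {n k : ℕ} (hk : 2 ≤ k) {u v : Fin n} (hvu : v < u) :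
    (graph n k).mult u v =
      if (v : ℕ) = 0 then min (u : ℕ) (k - 1) else if k ≤ (v : ℕ) + 1 then 1 else 0 := by
  have : {H ∈ arrangement n k | GivesArc H u v} = hyperplane v u ''
      {a : ℕ | 0 < a ∧ (((v : ℕ) = 0 ∧ a ≤ min (u : ℕ) (k - 1)) ∨ (k ≤ (v : ℕ) + 1 ∧ a = 1))} := by
    ext H
    simp only [Set.mem_ofPred_eq, Set.mem_image]
    constructor
    · rintro ⟨hH, ⟨h, _⟩ | ⟨a, ha, rfl⟩⟩
      · exact absurd hvu h.not_gt
      · exact ⟨a, ⟨ha, ((hyperplane_mem_arrangement_iff hk hvu.ne' ha).1 hH).2⟩, rfl⟩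
    · rintro ⟨a, ⟨ha, h⟩, rfl⟩
      exact ⟨(hyperplane_mem_arrangement_iff hk hvu.ne' ha).2 ⟨hvu, h⟩, Or.inr ⟨a, ha, rfl⟩⟩
  have hinj : Function.Injective (hyperplane v u) := fun a b hab => by
    rcases hyperplane_eq_hyperplane hvu.ne hvu.ne hab with h | h <;> omega
  simp only [graph]
  rw [this, Set.ncard_image_of_injective _ hinj]
  split_ifs with h1 h2
  · have : {a : ℕ | 0 < a ∧ (((v : ℕ) = 0 ∧ a ≤ min (u : ℕ) (k - 1)) ∨ (k ≤ (v : ℕ) + 1 ∧ a = 1))} =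
        (Finset.Icc 1 (min (u : ℕ) (k - 1)) : Finset ℕ) := by
      ext a
      simp only [Set.mem_ofPred_eq, Finset.coe_Icc, Set.mem_Icc]
      omega
    rw [this, Set.ncard_coe_finset, Nat.card_Icc]
    omega
  · rw [Set.ncard_eq_one]
    refine ⟨1, ?_⟩
    ext a
    simp only [Set.mem_ofPred_eq, Set.mem_singleton_iff]
    omega
  · convert Set.ncard_empty ℕ
    ext a
    simp only [Set.mem_ofPred_eq, Set.mem_empty_iff_false, iff_false]
    omega

/-- The arcs from a vertex `i < k` into a set `S`. -/
theorem sum_graph_mult_of_lt {n k : ℕ} (hk : 2 ≤ k) (hn : 0 < n) {i : Fin n}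
    (hik : (i : ℕ) + 1 < k) {S : Finset (Fin n)} (hiS : i ∉ S) :
    ∑ j ∈ S, (graph n k).mult i j =
      {j ∈ S | i < j}.card + if (⟨0, hn⟩ : Fin n) ∈ S then (i : ℕ) else 0 := by
  rw [Finset.card_filter, ← Finset.sum_ite_eq' S (⟨0, hn⟩ : Fin n) (fun _ => (i : ℕ)),
    ← Finset.sum_add_distrib]
  refine Finset.sum_congr rfl fun j hj => ?_
  simp only [Fin.ext_iff]
  rcases lt_trichotomy i j with h | rfl | h
  · rw [graph_mult_of_lt hk h, if_pos h, if_neg]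
    rw [Fin.lt_def] at h
    omega
    omega
  · exact absurd hj hiS
  · rw [graph_mult_of_gt hk h, if_neg h.not_gt]
    rw [Fin.lt_def] at h
    split_ifs <;> omega

/-- The arcs from a vertex `i ≥ k` into a set `S`. -/
theorem sum_graph_mult_of_ge {n k : ℕ} (hk : 2 ≤ k) (hn : 0 < n) {i : Fin n}
    (hik : k ≤ (i : ℕ) + 1) {S : Finset (Fin n)} (hiS : i ∉ S) :
    ∑ j ∈ S, (graph n k).mult i j =
      (S.filter fun j : Fin n => k ≤ (j : ℕ) + 1).card + if (⟨0, hn⟩ : Fin n) ∈ S then k - 1 else 0 := by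
  rw [Finset.card_filter, ← Finset.sum_ite_eq' S (⟨0, hn⟩ : Fin n) (fun _ => k - 1),
    ← Finset.sum_add_distrib]
  refine Finset.sum_congr rfl fun j hj => ?_
  simp only [Fin.ext_iff]
  rcases lt_trichotomy i j with h | rfl | h
  · rw [graph_mult_of_lt hk h]
    rw [Fin.lt_def] at h
    split_ifs <;> omega
  · exact absurd hj hiS
  · rw [graph_mult_of_gt hk h]
    rw [Fin.lt_def] at h
    split_ifs <;> omega

/-! ### Burning the multigraph in two phases -/

/-- `B` can be burnt, starting from the sink, by a process that does not use the arcs into the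
vertex `1`. The vertices `i < k` of `B` must then be central in `B`, whereas the entries of `a` on
`B ∩ {k, …, n}` form a parking function in the usual sense. -/
def IsBurnable {n : ℕ} (k : ℕ) (a : Fin n → ℕ) (B : Finset (Fin n)) : Prop :=
  (∀ i ∈ B, (i : ℕ) + 1 < k → a i ≤ {l ∈ B | i ≤ l}.card) ∧
    ∀ J ⊆ B, J.Nonempty → (∀ i ∈ J, k ≤ (i : ℕ) + 1) →
      ∃ i ∈ J, a i + J.card ≤ (B.filter fun l : Fin n => k ≤ (l : ℕ) + 1).card + 1

/-- The condition on the entries `a_k, …, a_n` under which every driver in `{k, …, n}` parks: they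
form a parking function after subtracting `k - 1`, with values below `1` allowed. -/
def IsTailParking {n : ℕ} (k : ℕ) (a : Fin n → ℕ) : Prop :=
  ∀ J : Finset (Fin n), J.Nonempty → (∀ i ∈ J, k ≤ (i : ℕ) + 1) → ∃ i ∈ J, a i + J.card ≤ n + 1

theorem card_filter_le_eq {n : ℕ} {B : Finset (Fin n)} {i : Fin n} (hi : i ∈ B) :
    {l ∈ B | i ≤ l}.card = {l ∈ B | i < l}.card + 1 := by
  have : {l ∈ B | i ≤ l} = insert i {l ∈ B | i < l} := by
    ext l
    simp only [Finset.mem_filter, Finset.mem_insert, le_iff_lt_or_eq]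
    constructor
    · rintro ⟨h, h1 | rfl⟩
      · exact Or.inr ⟨h, h1⟩
      · exact Or.inl rfl
    · rintro (rfl | ⟨h, h1⟩)
      · exact ⟨hi, Or.inr rfl⟩
      · exact ⟨h, Or.inl h1⟩
  rw [this, Finset.card_insert_of_notMem (by simp)]

theorem card_filter_tail {n k : ℕ} (hk : 2 ≤ k) (hkn : k ≤ n) :
    (Finset.univ.filter fun l : Fin n => k ≤ (l : ℕ) + 1).card = n + 1 - k := by
  have : (Finset.univ.filter fun l : Fin n => k ≤ (l : ℕ) + 1) = Finset.Ici (⟨k - 1, by omega⟩ : Fin n) := by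
    ext l
    simp only [Finset.mem_filter, Finset.mem_univ, true_and, Finset.mem_Ici, Fin.le_def]
    omega
  rw [this, Fin.card_Ici]
  simp only
  omega

theorem card_filter_tail_compl_add {n k : ℕ} (hk : 2 ≤ k) (hkn : k ≤ n) (I : Finset (Fin n)) :
    (Iᶜ.filter fun l : Fin n => k ≤ (l : ℕ) + 1).card +
      (I.filter fun l : Fin n => k ≤ (l : ℕ) + 1).card = n + 1 - k := by
  rw [← card_filter_tail hk hkn, ← Finset.card_union_of_disjoint
    (Finset.disjoint_filter_filter disjoint_compl_left), ← Finset.filter_union, Finset.union_comm,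
    Finset.union_compl]

theorem outdegree_graph {n k : ℕ} (hk : 2 ≤ k) (hkn : k ≤ n) (i : Fin n) :
    ∑ j ∈ {i}ᶜ, (graph n k).mult i j = n - 1 := by
  have hn : 0 < n := by omega
  have h0 : (⟨0, hn⟩ : Fin n) ∈ ({i}ᶜ : Finset (Fin n)) ↔ (i : ℕ) ≠ 0 := by
    rw [Finset.mem_compl, Finset.mem_singleton, Fin.ext_iff, ne_comm]
  rcases lt_or_ge ((i : ℕ) + 1) k with hik | hik
  · have h1 : {l ∈ ({i} : Finset (Fin n))ᶜ | i < l} = Finset.Ioi i := by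
      ext l
      simp only [Finset.mem_filter, Finset.mem_compl, Finset.mem_singleton, Finset.mem_Ioi,
        and_iff_right_iff_imp]
      exact fun h => h.ne'
    rw [sum_graph_mult_of_lt hk hn hik (by simp), h1, Fin.card_Ioi]
    split_ifs with h <;> rw [h0] at h <;> omega
  · have h1 := card_filter_tail_compl_add hk hkn {i}
    rw [Finset.filter_singleton, if_pos hik, Finset.card_singleton] at h1
    rw [sum_graph_mult_of_ge hk hn hik (by simp), if_pos (h0.2 (by omega))]
    omega

/-- A burnable set can be enlarged by any vertex to which the fire spreads. -/
theorem IsBurnable.insert {n k : ℕ} {a : Fin n → ℕ} {B : Finset (Fin n)} (hB : IsBurnable k a B)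
    {i : Fin n} (hi : i ∉ B) (hlow : (i : ℕ) + 1 < k → a i ≤ {l ∈ B | i < l}.card + 1)
    (hhigh : k ≤ (i : ℕ) + 1 → a i ≤ (B.filter fun l : Fin n => k ≤ (l : ℕ) + 1).card + 1) :
    IsBurnable k a (insert i B) := by
  refine ⟨fun j hj hjk => ?_, fun J hJ hJne hJk => ?_⟩
  · rcases Finset.mem_insert.1 hj with rfl | hjB
    · rw [card_filter_le_eq hj, Finset.filter_insert, if_neg (lt_irrefl _)]
      exact hlow hjk
    · exact (hB.1 j hjB hjk).trans (Finset.card_le_card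
        (Finset.filter_subset_filter _ (Finset.subset_insert _ _)))
  · by_cases hiJ : i ∈ J
    · have hik := hJk i hiJ
      rw [Finset.filter_insert, if_pos hik, Finset.card_insert_of_notMem (by simp [hi])]
      have hcard := Finset.card_erase_add_one hiJ
      rcases (J.erase i).eq_empty_or_nonempty with he | hne
      · rw [he, Finset.card_empty] at hcard
        exact ⟨i, hiJ, by have := hhigh hik; omega⟩
      · obtain ⟨j, hj, hle⟩ := hB.2 (J.erase i)
          (fun x hx => ((Finset.mem_insert.1 (hJ (Finset.mem_of_mem_erase hx))).resolve_left
            (Finset.ne_of_mem_erase hx))) hne (fun x hx => hJk x (Finset.mem_of_mem_erase hx))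
        exact ⟨j, Finset.mem_of_mem_erase hj, by omega⟩
    · obtain ⟨j, hj, hle⟩ := hB.2 J ((Finset.subset_insert_iff_of_notMem hiJ).1 hJ) hJne hJk
      refine ⟨j, hj, hle.trans ?_⟩
      gcongr
      exact Finset.subset_insert _ _

theorem exists_isBurnable_of_isParkingFunction {n k : ℕ} (hk : 2 ≤ k) (hn : 0 < n)
    {a : Fin n → ℕ} (ha : (graph n k).IsParkingFunction a) :
    ∃ B, (⟨0, hn⟩ : Fin n) ∈ B ∧ IsBurnable k a B := by
  classical
  obtain ⟨B, hB, hmax⟩ := Finset.exists_max_image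
    {B : Finset (Fin n) | IsBurnable k a B}.toFinset Finset.card
    ⟨∅, by
      rw [Set.mem_toFinset]
      refine ⟨by simp, fun J hJ hne => ?_⟩
      exact absurd (Finset.subset_empty.1 hJ) hne.ne_empty⟩
  rw [Set.mem_toFinset] at hB
  refine ⟨B, ?_, hB⟩
  by_contra h0
  obtain ⟨i, hi, hlt⟩ := ha.2 Bᶜ ⟨_, Finset.mem_compl.2 h0⟩
  rw [compl_compl] at hlt
  have hiB := Finset.mem_compl.1 hi
  have := hmax (insert i B) (by
    rw [Set.mem_toFinset]
    refine hB.insert hiB (fun hik => ?_) (fun hik => ?_)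
    · rw [sum_graph_mult_of_lt hk hn hik hiB, if_neg h0] at hlt
      omega
    · rw [sum_graph_mult_of_ge hk hn hik hiB, if_neg h0] at hlt
      omega)
  rw [Finset.card_insert_of_notMem hiB] at this
  omega

theorem isTailParking_of_isParkingFunction {n k : ℕ} (hk : 2 ≤ k) (hkn : k ≤ n) {a : Fin n → ℕ}
    (ha : (graph n k).IsParkingFunction a) : IsTailParking k a := by
  intro J hJ hJk
  have hn : 0 < n := by omega
  obtain ⟨i, hi, hlt⟩ := ha.2 J hJ
  refine ⟨i, hi, ?_⟩
  have h0 : (⟨0, hn⟩ : Fin n) ∈ Jᶜ := Finset.mem_compl.2 fun h => by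
    have := hJk _ h
    simp only at this
    omega
  rw [sum_graph_mult_of_ge hk hn (hJk i hi) (by simpa using hi), if_pos h0] at hlt
  have := card_filter_tail_compl_add hk hkn J
  rw [Finset.filter_true_of_mem hJk] at this
  omega

theorem le_of_isParkingFunction {n k : ℕ} (hk : 2 ≤ k) (hkn : k ≤ n) {a : Fin n → ℕ}
    (ha : (graph n k).IsParkingFunction a) (i : Fin n) : a i ≤ n := by
  obtain ⟨j, hj, hlt⟩ := ha.2 {i} (Finset.singleton_nonempty i)
  obtain rfl := Finset.mem_singleton.1 hj
  rw [outdegree_graph hk hkn] at hlt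
  omega

/-- The fire first burns a set containing the vertex `1`; after that the remaining vertices of
`{k, …, n}` burn, and finally those of `{2, …, k - 1}` in descending order. -/
theorem isParkingFunction_of_isBurnable {n k : ℕ} (hk : 2 ≤ k) (hkn : k ≤ n) (hn : 0 < n)
    {a : Fin n → ℕ} (ha : ∀ i, 1 ≤ a i ∧ a i ≤ n) (htail : IsTailParking k a)
    {B : Finset (Fin n)} (hB0 : (⟨0, hn⟩ : Fin n) ∈ B) (hB : IsBurnable k a B) :
    (graph n k).IsParkingFunction a := by
  refine ⟨fun v => (ha v).1, fun I hI => ?_⟩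
  by_cases h0 : (⟨0, hn⟩ : Fin n) ∈ I
  · rcases ((I ∩ B).filter fun l : Fin n => k ≤ (l : ℕ) + 1).eq_empty_or_nonempty with he | hne
    · obtain ⟨i, hi, hmax⟩ := Finset.exists_max_image (I ∩ B) id
        ⟨_, Finset.mem_inter.2 ⟨h0, hB0⟩⟩
      obtain ⟨hiI, hiB⟩ := Finset.mem_inter.1 hi
      have hik : (i : ℕ) + 1 < k := by
        by_contra hc
        have : i ∈ ((I ∩ B).filter fun l : Fin n => k ≤ (l : ℕ) + 1) :=
          Finset.mem_filter.2 ⟨hi, by omega⟩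
        rw [he] at this
        exact absurd this (Finset.notMem_empty _)
      refine ⟨i, hiI, ?_⟩
      rw [sum_graph_mult_of_lt hk hn hik (by simpa using hiI)]
      have h1 := hB.1 i hiB hik
      rw [card_filter_le_eq hiB] at h1
      have h2 : {l ∈ B | i < l}.card ≤ {l ∈ Iᶜ | i < l}.card := by
        refine Finset.card_le_card fun l hl => ?_
        obtain ⟨hlB, hil⟩ := Finset.mem_filter.1 hl
        refine Finset.mem_filter.2 ⟨Finset.mem_compl.2 fun hlI => ?_, hil⟩
        exact absurd (hmax l (Finset.mem_inter.2 ⟨hlI, hlB⟩)) (not_le.2 hil)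
      omega
    · obtain ⟨i, hi, hle⟩ := hB.2 _ (fun x hx =>
        (Finset.mem_inter.1 (Finset.mem_filter.1 hx).1).2) hne
        (fun x hx => (Finset.mem_filter.1 hx).2)
      obtain ⟨hi, hik⟩ := Finset.mem_filter.1 hi
      obtain ⟨hiI, hiB⟩ := Finset.mem_inter.1 hi
      refine ⟨i, hiI, ?_⟩
      rw [sum_graph_mult_of_ge hk hn hik (by simpa using hiI)]
      have h2 : (B.filter fun l : Fin n => k ≤ (l : ℕ) + 1).card ≤
          (Iᶜ.filter fun l : Fin n => k ≤ (l : ℕ) + 1).card +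
            ((I ∩ B).filter fun l : Fin n => k ≤ (l : ℕ) + 1).card := by
        refine (Finset.card_le_card fun l hl => ?_).trans (Finset.card_union_le _ _)
        simp only [Finset.mem_union, Finset.mem_filter, Finset.mem_compl,
          Finset.mem_inter] at hl ⊢
        tauto
      omega
  · have h0' : (⟨0, hn⟩ : Fin n) ∈ Iᶜ := Finset.mem_compl.2 h0
    rcases (I.filter fun l : Fin n => k ≤ (l : ℕ) + 1).eq_empty_or_nonempty with he | hne
    · obtain ⟨i, hiI, hmax⟩ := Finset.exists_max_image I id hI
      have hik : (i : ℕ) + 1 < k := by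
        by_contra hc
        have : i ∈ (I.filter fun l : Fin n => k ≤ (l : ℕ) + 1) :=
          Finset.mem_filter.2 ⟨hiI, by omega⟩
        rw [he] at this
        exact absurd this (Finset.notMem_empty _)
      refine ⟨i, hiI, ?_⟩
      rw [sum_graph_mult_of_lt hk hn hik (by simpa using hiI), if_pos h0']
      have h1 : {l ∈ Iᶜ | i < l} = Finset.Ioi i := by
        ext l
        simp only [Finset.mem_filter, Finset.mem_compl, Finset.mem_Ioi, and_iff_right_iff_imp]
        exact fun hil hlI => absurd (hmax l hlI) (not_le.2 hil)
      rw [h1, Fin.card_Ioi]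
      have := (ha i).2
      omega
    · obtain ⟨i, hi, hle⟩ := htail _ hne (fun x hx => (Finset.mem_filter.1 hx).2)
      obtain ⟨hiI, hik⟩ := Finset.mem_filter.1 hi
      refine ⟨i, hiI, ?_⟩
      rw [sum_graph_mult_of_ge hk hn hik (by simpa using hiI), if_pos h0']
      have := card_filter_tail_compl_add hk hkn I
      omega

/-! ### The determinant of the reduced Laplacian -/

/-- Replacing the first column of `M` by the sum of all columns, which is constant `1`, and then
adding it to every other column makes `M` lower triangular. -/
theorem det_of_rowSum_eq_one {m : ℕ} (M : Matrix (Fin (m + 1)) (Fin (m + 1)) ℤ) (d : ℤ)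
    (hrow : ∀ i, ∑ j, M i j = 1) (hupper : ∀ i j, i < j → M i j = -1)
    (hdiag : ∀ i, i ≠ 0 → M i i = d) : M.det = (d + 1) ^ m := by
  set A : Matrix (Fin (m + 1)) (Fin (m + 1)) ℤ :=
    Matrix.of fun i j => if j = 0 then 1 else if i = j then 1 else 0 with hA
  set U : Matrix (Fin (m + 1)) (Fin (m + 1)) ℤ :=
    Matrix.of fun i j => if i = 0 then 1 else if i = j then 1 else 0 with hU
  have hdetA : A.det = 1 := by
    rw [Matrix.det_of_isLowerTriangular]
    · simp [hA]
    · intro i j hij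
      replace hij : i < j := hij
      simp [hA, hij.ne, Fin.ne_zero_of_lt hij]
  have hdetU : U.det = 1 := by
    rw [Matrix.det_of_isUpperTriangular]
    · simp [hU]
    · intro i j hij
      replace hij : j < i := hij
      simp [hU, hij.ne', Fin.ne_zero_of_lt hij]
  have hMA : ∀ i j, (M * A) i j = if j = 0 then 1 else M i j := by
    intro i j
    split_ifs with hj
    · simp [Matrix.mul_apply, hA, hj, hrow]
    · simp [Matrix.mul_apply, hA, hj]
  have hMAU : ∀ i j, (M * A * U) i j = if j = 0 then 1 else 1 + M i j := by
    intro i j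
    rw [Matrix.mul_apply, Fin.sum_univ_succ]
    refine Fin.cases ?_ (fun j => ?_) j
    · simp [hMA, hU, Fin.succ_ne_zero]
    · simp [hMA, hU, Fin.succ_ne_zero]
  have hdet : (M * A * U).det = M.det := by rw [Matrix.det_mul, Matrix.det_mul, hdetA, hdetU]; ring
  rw [← hdet, Matrix.det_of_isLowerTriangular, Fin.prod_univ_succ]
  · simp [hMAU, Fin.succ_ne_zero, hdiag, add_comm]
  · intro i j hij
    replace hij : i < j := hij
    rw [hMAU, if_neg (Fin.ne_zero_of_lt hij), hupper i j hij, add_neg_cancel]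

theorem det_reducedLaplacian_graph {n k : ℕ} (hk : 2 ≤ k) (hkn : k ≤ n) :
    (graph n k).reducedLaplacian.det = ((n : ℤ) + 1) ^ (n - 1) := by
  obtain ⟨m, rfl⟩ : ∃ m, n = m + 1 := ⟨n - 1, by omega⟩
  rw [Nat.add_sub_cancel]
  refine det_of_rowSum_eq_one _ _ (fun i => ?_) (fun i j hij => ?_) fun i _ => ?_
  · have h := (graph (m + 1) k).reducedLaplacian_mulVec (fun _ => 1) i
    simpa [Matrix.mulVec, dotProduct] using h
  · simp [MultiDigraph.reducedLaplacian, Matrix.diagonal_apply_ne _ hij.ne, graph_mult_of_lt hk hij]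
  · have hsum : ∑ v, (graph (m + 1) k).mult i v = m := by
      have h1 : ∑ v ∈ {i}ᶜ, (graph (m + 1) k).mult i v = ∑ v, (graph (m + 1) k).mult i v := by
        rw [← Finset.sum_add_sum_compl {i}, Finset.sum_singleton, (graph (m + 1) k).loopless,
          zero_add]
      rw [← h1]
      exact outdegree_graph hk hkn i
    rw [MultiDigraph.reducedLaplacian, Matrix.sub_apply, Matrix.diagonal_apply_eq, Matrix.of_apply,
      (graph (m + 1) k).loopless, ← Nat.cast_sum, hsum]
    push_cast
    ring

/-! ### The parking process of the drivers `k, …, n` -/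

theorem place_spec {n : ℕ} (a : Fin n → ℕ) (i : Fin n) :
    a i ≤ place a i ∧ ∀ j, i < j → place a j ≠ place a i := by
  have hne : {p | a i ≤ p ∧ ∀ j, (_h : i < j) → place a j ≠ p}.Nonempty := by
    refine ⟨a i + ∑ j, place a j + 1, by omega, fun j _ => ?_⟩
    have := Finset.single_le_sum (f := place a) (fun _ _ => Nat.zero_le _) (Finset.mem_univ j)
    omega
  have := Nat.sInf_mem hne
  rw [← place] at this
  exact this

theorem exists_place_eq_of_lt {n : ℕ} {a : Fin n → ℕ} {i : Fin n} {p : ℕ} (h1 : a i ≤ p)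
    (h2 : p < place a i) : ∃ j, i < j ∧ place a j = p := by
  rw [place] at h2
  have := Nat.notMem_of_lt_sInf h2
  simp only [Set.mem_ofPred_eq, not_and, not_forall, not_not] at this
  obtain ⟨j, hij, hj⟩ := this h1
  exact ⟨j, hij, hj⟩

theorem place_injective {n : ℕ} (a : Fin n → ℕ) : Function.Injective (place a) := by
  intro i j hij
  rcases lt_trichotomy i j with h | h | h
  · exact absurd hij.symm ((place_spec a i).2 j h)
  · exact h
  · exact absurd hij ((place_spec a j).2 i h)

theorem isTailParking_of_parks {n k : ℕ} {a : Fin n → ℕ}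
    (h : ∀ i : Fin n, k ≤ (i : ℕ) + 1 → Parks a i) : IsTailParking k a := by
  intro J hJ hJk
  obtain ⟨i, hi, hmin⟩ := Finset.exists_min_image J (place a) hJ
  refine ⟨i, hi, ?_⟩
  have h1 : J.card ≤ (Finset.Icc (place a i) n).card :=
    Finset.card_le_card_of_injOn (place a)
      (fun j hj => Finset.mem_coe.2 (Finset.mem_Icc.2 ⟨hmin j hj, h j (hJk j hj)⟩))
      (place_injective a).injOn
  rw [Nat.card_Icc] at h1
  have h2 := (place_spec a i).1
  have h3 : place a i ≤ n := h i (hJk i hi)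
  omega

/-- If driver `i` does not park, consider the longest block of places `p, …, n` that is occupied
when `i` enters the street. The drivers in this block all prefer places from `p` on, and so does
`i`. -/
theorem parks_of_isTailParking {n k : ℕ} {a : Fin n → ℕ} (ha : ∀ i, 1 ≤ a i)
    (h : IsTailParking k a) {i : Fin n} (hik : k ≤ (i : ℕ) + 1) : Parks a i := by
  classical
  by_contra hi
  rw [Parks, not_le] at hi
  have hex : ∃ p, ∀ q, p ≤ q → q ≤ n → ∃ j, i < j ∧ place a j = q :=
    ⟨a i, fun q h1 h2 => exists_place_eq_of_lt h1 (by omega)⟩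
  obtain ⟨p, hp, hpmin⟩ : ∃ p, (∀ q, p ≤ q → q ≤ n → ∃ j, i < j ∧ place a j = q) ∧
      ∀ p' < p, ¬ ∀ q, p' ≤ q → q ≤ n → ∃ j, i < j ∧ place a j = q :=
    ⟨Nat.find hex, Nat.find_spec hex, fun p' => Nat.find_min hex⟩
  have hpi : p ≤ a i := by
    by_contra! hc
    exact hpmin _ hc fun q h1 h2 => exists_place_eq_of_lt h1 (by omega)
  have hp0 : p ≠ 0 := by
    rintro rfl
    obtain ⟨j, -, hj⟩ := hp 0 le_rfl (Nat.zero_le _)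
    have h1 := (place_spec a j).1
    have h2 := ha j
    omega
  have hfree : ∀ j, i < j → place a j ≠ p - 1 := by
    intro j hij hj
    refine hpmin (p - 1) (by omega) fun q h1 h2 => ?_
    rcases eq_or_lt_of_le h1 with rfl | h1
    · exact ⟨j, hij, hj⟩
    · exact hp q (by omega) h2
  set J : Finset (Fin n) := {j | i < j ∧ p ≤ place a j} with hJ
  have hiJ : i ∉ J := by simp [hJ]
  have hcard : n + 1 - p ≤ J.card := by
    rw [← Nat.card_Icc]
    refine (Finset.card_le_card fun q hq => ?_).trans (Finset.card_image_le (f := place a))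
    obtain ⟨h1, h2⟩ := Finset.mem_Icc.1 hq
    obtain ⟨j, hij, rfl⟩ := hp q h1 h2
    exact Finset.mem_image_of_mem _ (by simp [hJ, hij, h1])
  have hpJ : ∀ j ∈ insert i J, i ≤ j ∧ p ≤ a j := by
    intro j hj
    rcases Finset.mem_insert.1 hj with rfl | hj
    · exact ⟨le_rfl, hpi⟩
    · obtain ⟨hij, hpj⟩ : i < j ∧ p ≤ place a j := by simpa [hJ] using hj
      refine ⟨hij.le, ?_⟩
      by_contra! hc
      obtain ⟨l, hjl, hl⟩ := exists_place_eq_of_lt (a := a) (i := j) (p := p - 1) (by omega)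
        (by omega)
      exact hfree l (hij.trans hjl) hl
  obtain ⟨j, hj, hle⟩ := h (insert i J) (Finset.insert_nonempty _ _) fun j hj => by
    have := (hpJ j hj).1
    rw [Fin.le_def] at this
    omega
  rw [Finset.card_insert_of_notMem hiJ] at hle
  have := (hpJ j hj).2
  omega

/-! ### Burnable sets and the centre of the rearrangement -/

section Sorting

variable {n k : ℕ} {a : Fin n → ℕ} {π : Equiv.Perm (Fin n)}

theorem IsSorting.le_apply_iff (hπ : IsSorting k a π) (l : Fin n) :
    k ≤ (π l : ℕ) + 1 ↔ k ≤ (l : ℕ) + 1 := by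
  constructor
  · intro h
    by_contra! hc
    rw [hπ.1 l hc] at h
    omega
  · intro h
    by_contra! hc
    rw [π.injective (hπ.1 _ hc)] at hc
    omega

theorem IsSorting.antitone (hπ : IsSorting k a π) {i j : Fin n} (hik : k ≤ (i : ℕ) + 1)
    (hij : i ≤ j) : a (π j) ≤ a (π i) := by
  obtain ⟨j, hj⟩ := j
  rw [Fin.le_def] at hij
  simp only at hij
  induction j, hij using Nat.le_induction with
  | base => exact le_rfl
  | succ m him ih =>
    exact (hπ.2 ⟨m, by omega⟩ ⟨m + 1, hj⟩ (by simp only; omega) rfl).trans (ih (by omega))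

theorem exists_isSorting (k : ℕ) (a : Fin n → ℕ) : ∃ π, IsSorting k a π := by
  classical
  set e := Fintype.orderIsoFinOfCardEq {i : Fin n // k ≤ (i : ℕ) + 1} rfl
  set σ := Tuple.sort fun m => OrderDual.toDual (a (e m))
  refine ⟨Equiv.Perm.ofSubtype (e.toEquiv.permCongr σ), fun i hi => ?_, fun i j hi hij => ?_⟩
  · exact Equiv.Perm.ofSubtype_apply_of_not_mem _ (by omega)
  · have hj : k ≤ (j : ℕ) + 1 := by omega
    rw [Equiv.Perm.ofSubtype_apply_of_mem (a := i) _ hi,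
      Equiv.Perm.ofSubtype_apply_of_mem (a := j) _ hj]
    have h1 : e.symm ⟨i, hi⟩ ≤ e.symm ⟨j, hj⟩ := by
      rw [OrderIso.le_iff_le, Subtype.mk_le_mk, Fin.le_def]
      omega
    exact OrderDual.toDual_le_toDual.1
      (Tuple.monotone_sort (fun m => OrderDual.toDual (a (e m))) h1)

theorem IsCentral.isBurnable_map (hπ : IsSorting k a π) {X : Finset (Fin n)}
    (hX : IsCentral (a ∘ π) X) : IsBurnable k a (X.map π.toEmbedding) := by
  refine ⟨fun i hi hik => ?_, fun J hJ hJne hJk => ?_⟩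
  · obtain ⟨x, hx, hxi⟩ := Finset.mem_map.1 hi
    obtain rfl : x = i := π.injective (hxi.trans (hπ.1 i hik).symm)
    have h1 := hX x hx
    rw [Function.comp_apply, hπ.1 x hik] at h1
    refine h1.trans (Finset.card_le_card_of_injOn π (fun l hl => ?_) π.injective.injOn)
    obtain ⟨hlX, hxl⟩ := Finset.mem_filter.1 (Finset.mem_coe.1 hl)
    refine Finset.mem_coe.2 (Finset.mem_filter.2 ⟨Finset.mem_map_of_mem _ hlX, ?_⟩)
    by_cases hlk : k ≤ (l : ℕ) + 1
    · have := (hπ.le_apply_iff l).2 hlk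
      rw [Fin.le_def]
      omega
    · rwa [hπ.1 l (by omega)]
  · have hne : (J.map π.symm.toEmbedding).Nonempty := hJne.map
    obtain ⟨x, hx, hmax⟩ := Finset.exists_max_image (J.map π.symm.toEmbedding) id hne
    have hmem : ∀ y ∈ J.map π.symm.toEmbedding, π y ∈ J ∧ y ∈ X ∧ k ≤ (y : ℕ) + 1 := by
      intro y hy
      obtain ⟨z, hz, rfl⟩ := Finset.mem_map.1 hy
      obtain ⟨w, hw, hwz⟩ := Finset.mem_map.1 (hJ hz)
      have hwz' : π.symm z = w := by rw [← hwz]; exact π.symm_apply_apply w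
      simp only [Equiv.coe_toEmbedding, Equiv.apply_symm_apply]
      refine ⟨hz, hwz' ▸ hw, (hπ.le_apply_iff _).1 ?_⟩
      rw [Equiv.apply_symm_apply]
      exact hJk z hz
    obtain ⟨hxJ, hxX, hxk⟩ := hmem x hx
    refine ⟨π x, hxJ, ?_⟩
    have h1 : a (π x) ≤ {l ∈ X | x ≤ l}.card := hX x hxX
    have h2 : ((X.map π.toEmbedding).filter fun l : Fin n => k ≤ (l : ℕ) + 1).card =
        (X.filter fun l : Fin n => k ≤ (l : ℕ) + 1).card := by
      rw [Finset.filter_map, Finset.card_map]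
      congr 1
      ext l
      simp only [Finset.mem_filter, Function.comp_apply, Equiv.coe_toEmbedding, hπ.le_apply_iff]
    have h3 := Finset.card_union_add_card_inter {l ∈ X | x ≤ l} (J.map π.symm.toEmbedding)
    rw [Finset.card_map] at h3
    have h4 : ({l ∈ X | x ≤ l} ∪ J.map π.symm.toEmbedding).card ≤
        (X.filter fun l : Fin n => k ≤ (l : ℕ) + 1).card := by
      refine Finset.card_le_card (Finset.union_subset (fun l hl => ?_) fun l hl => ?_)
      · obtain ⟨hlX, hxl⟩ := Finset.mem_filter.1 hl
        rw [Fin.le_def] at hxl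
        exact Finset.mem_filter.2 ⟨hlX, by omega⟩
      · exact Finset.mem_filter.2 (hmem l hl).2
    have h5 : ({l ∈ X | x ≤ l} ∩ J.map π.symm.toEmbedding).card ≤ 1 := by
      refine (Finset.card_le_card (t := {x}) fun l hl => ?_).trans_eq (Finset.card_singleton x)
      obtain ⟨hl1, hl2⟩ := Finset.mem_inter.1 hl
      exact Finset.mem_singleton.2 (le_antisymm (hmax l hl2) (Finset.mem_filter.1 hl1).2)
    omega

/-- A central set for the sorted sequence is obtained from a burnable set `B` by pushing its `c`
elements in `{k, …, n}` to the top `c` positions. -/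
theorem IsBurnable.exists_isCentral (hπ : IsSorting k a π) (hk : 2 ≤ k) (hkn : k ≤ n)
    {B : Finset (Fin n)} (hB : IsBurnable k a B) :
    ∃ X, IsCentral (a ∘ π) X ∧ ∀ i ∈ B, (i : ℕ) + 1 < k → i ∈ X := by
  set T := B.filter fun l : Fin n => k ≤ (l : ℕ) + 1 with hT
  have hTc : T.card ≤ n + 1 - k := by
    rw [← card_filter_tail hk hkn]
    exact Finset.card_le_card (Finset.filter_subset_filter _ (Finset.subset_univ _))
  set U : Finset (Fin n) := {l | n ≤ (l : ℕ) + T.card} with hU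
  have hUc : U.card = T.card := by
    rcases Nat.eq_zero_or_pos T.card with h0 | hpos
    · rw [h0, Finset.card_eq_zero, hU, h0]
      refine Finset.filter_eq_empty_iff.2 fun l _ => ?_
      omega
    · have : U = Finset.Ici (⟨n - T.card, by omega⟩ : Fin n) := by
        ext l
        simp only [hU, Finset.mem_filter, Finset.mem_univ, true_and, Finset.mem_Ici, Fin.le_def]
        omega
      rw [this, Fin.card_Ici]
      simp only
      omega
  refine ⟨(B.filter fun l : Fin n => (l : ℕ) + 1 < k) ∪ U, fun i hi => ?_, fun i hi hik =>
    Finset.mem_union_left _ (Finset.mem_filter.2 ⟨hi, hik⟩)⟩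
  rw [Function.comp_apply]
  rcases Finset.mem_union.1 hi with hi | hi
  · obtain ⟨hiB, hik⟩ := Finset.mem_filter.1 hi
    rw [hπ.1 i hik]
    have h1 : {l ∈ B | i ≤ l} ⊆ {l ∈ (B.filter fun l : Fin n => (l : ℕ) + 1 < k) | i ≤ l} ∪ T := by
      intro l hl
      simp only [hT, Finset.mem_union, Finset.mem_filter] at hl ⊢
      have := lt_or_ge ((l : ℕ) + 1) k
      tauto
    have h2 : {l ∈ (B.filter fun l : Fin n => (l : ℕ) + 1 < k) | i ≤ l} ∪ U ⊆
        {l ∈ (B.filter fun l : Fin n => (l : ℕ) + 1 < k) ∪ U | i ≤ l} := by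
      intro l hl
      rcases Finset.mem_union.1 hl with hl | hl
      · obtain ⟨h3, h4⟩ := Finset.mem_filter.1 hl
        exact Finset.mem_filter.2 ⟨Finset.mem_union_left _ h3, h4⟩
      · refine Finset.mem_filter.2 ⟨Finset.mem_union_right _ hl, ?_⟩
        have : n ≤ (l : ℕ) + T.card := by simpa [hU] using hl
        rw [Fin.le_def]
        omega
    have h3 : Disjoint {l ∈ (B.filter fun l : Fin n => (l : ℕ) + 1 < k) | i ≤ l} U := by
      refine Finset.disjoint_left.2 fun l hl hl' => ?_
      have h4 : (l : ℕ) + 1 < k := (Finset.mem_filter.1 (Finset.mem_filter.1 hl).1).2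
      have h5 : n ≤ (l : ℕ) + T.card := by simpa [hU] using hl'
      omega
    calc a i ≤ {l ∈ B | i ≤ l}.card := hB.1 i hiB hik
      _ ≤ _ := (Finset.card_le_card h1).trans (Finset.card_union_le _ _)
      _ = _ := by rw [← hUc, Finset.card_union_of_disjoint h3]
      _ ≤ _ := Finset.card_le_card h2
  · have hin : n ≤ (i : ℕ) + T.card := by simpa [hU] using hi
    have h1 : n - i ≤ {l ∈ (B.filter fun l : Fin n => (l : ℕ) + 1 < k) ∪ U | i ≤ l}.card := by
      rw [← Fin.card_Ici]
      refine Finset.card_le_card fun l hl => Finset.mem_filter.2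
        ⟨Finset.mem_union_right _ ?_, Finset.mem_Ici.1 hl⟩
      have := Fin.le_def.1 (Finset.mem_Ici.1 hl)
      simp only [hU, Finset.mem_filter, Finset.mem_univ, true_and]
      omega
    refine le_trans ?_ h1
    by_contra! hc
    -- At least `n - i` entries on `T` are at most `n - i`, but sorting has placed all such entries
    -- at the `n - i - 1` positions after `i`.
    have h2 : n - i ≤ {l ∈ T | a l ≤ n - i}.card := by
      have h3 := Finset.card_filter_add_card_filter_not (s := T) fun l => a l ≤ n - i
      rcases {l ∈ T | ¬ a l ≤ n - i}.eq_empty_or_nonempty with he | hne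
      · rw [he, Finset.card_empty] at h3
        omega
      · obtain ⟨j, hj, hle⟩ := hB.2 _ (fun x hx =>
          (Finset.mem_filter.1 (Finset.mem_filter.1 hx).1).1) hne
          (fun x hx => (Finset.mem_filter.1 (Finset.mem_filter.1 hx).1).2)
        have h4 := (Finset.mem_filter.1 hj).2
        rw [← hT] at hle
        omega
    have h3 : {l ∈ T | a l ≤ n - i}.card ≤ (Finset.Ioi i).card := by
      refine Finset.card_le_card_of_injOn π.symm (fun l hl => ?_) π.symm.injective.injOn
      obtain ⟨hlT, hla⟩ := Finset.mem_filter.1 (Finset.mem_coe.1 hl)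
      have hlk : k ≤ (l : ℕ) + 1 := (Finset.mem_filter.1 hlT).2
      refine Finset.mem_coe.2 (Finset.mem_Ioi.2 ?_)
      by_contra! hli
      have h4 := hπ.antitone ((hπ.le_apply_iff _).1 (by rwa [π.apply_symm_apply])) hli
      rw [π.apply_symm_apply] at h4
      omega
    rw [Fin.card_Ioi] at h3
    omega

end Sorting

theorem isParkingFunction_iff_isPartialParkingFunction {n k : ℕ} (hk : 2 ≤ k) (hkn : k ≤ n)
    (a : Fin n → ℕ) : (graph n k).IsParkingFunction a ↔ IsPartialParkingFunction n k a := by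
  have hn : 0 < n := by omega
  constructor
  · intro ha
    refine ⟨fun i => ⟨ha.1 i, le_of_isParkingFunction hk hkn ha i⟩, fun i hi =>
      parks_of_isTailParking ha.1 (isTailParking_of_isParkingFunction hk hkn ha) hi, ?_⟩
    obtain ⟨π, hπ⟩ := exists_isSorting k a
    obtain ⟨B, hB0, hB⟩ := exists_isBurnable_of_isParkingFunction hk hn ha
    obtain ⟨X, hX, hBX⟩ := hB.exists_isCentral hπ hk hkn
    exact ⟨π, hπ, ⟨0, hn⟩, (isGreatest_centre _).2 hX (hBX _ hB0 (by simp only; omega)), rfl⟩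
  · rintro ⟨ha, hpark, π, hπ, o, ho, ho1⟩
    obtain rfl : o = ⟨0, hn⟩ := Fin.ext (by simp only; omega)
    refine isParkingFunction_of_isBurnable hk hkn hn ha (isTailParking_of_parks hpark)
      ?_ ((isGreatest_centre (a ∘ π)).1.isBurnable_map hπ)
    have h1 : π ⟨0, hn⟩ = ⟨0, hn⟩ := hπ.1 _ (by simp only; omega)
    have h2 := Finset.mem_map_of_mem π.toEmbedding ho
    rwa [Equiv.coe_toEmbedding, h1] at h2

end ShiIsh

theorem theorem4p1 (n k : ℕ) (hk : 2 ≤ k) (hkn : k ≤ n) :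
    (∀ a : Fin n → ℕ,
      (ShiIsh.graph n k).IsParkingFunction a ↔ ShiIsh.IsPartialParkingFunction n k a) ∧
    {a : Fin n → ℕ | (ShiIsh.graph n k).IsParkingFunction a}.ncard = (n + 1) ^ (n - 1) := by
  refine ⟨ShiIsh.isParkingFunction_iff_isPartialParkingFunction hk hkn, ?_⟩
  rw [ShiIsh.MultiDigraph.ncard_isParkingFunction, ShiIsh.det_reducedLaplacian_graph hk hkn,
    Int.natAbs_pow]
  rfl
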